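/- Let $\mathbb O$ be the octonions with basis $e_0=1,e_1,\dots,e_7$, where $e_ie_i=-1$ for $i\ge 1$ and $e_ae_b=e_c=-e_be_a$ for all cyclic rotations $(a,b,c)$ of the triples $(123),(145),(176),(246),(257),(347),(365)$; let $\overline{x}$, $\operatorname{Re}x$ and $|x|$ be conjugate, real part and modulus, and $\mathbb S=\{J\in\mathbb O:\operatorname{Re}J=0,\ |J|=1\}$. An $\mathbb O$-bimodule is a real vector space $M$ with real-bilinear unital left and right multiplications by $\mathbb O$ such that $[p,q,x]=[q,x,p]=[x,p,q]=-[q,p,x]$ for all $p,q\in\mathbb O$, $x\in M$, where $[a,b,c]=(ab)c-a(bc)$. Its real part is $\operatorname{Re}M=\{m\in M:[p,q,m]=0\ \ \forall p,q\in\mathbb O\}$, with projection $\operatorname{Re}:M\to\operatorname{Re}M$, $\operatorname{Re}m=\frac5{12}m-\frac1{12}\sum_{i=1}^7 e_ime_i$. A real-linear map $f:M\to M'$ of $\mathbb O$-bimodules is right para-linear if $\operatorname{Re}B_p(f,x)=0$ for all $p\in\mathbb O$, $x\in M$, where $B_p(f,x)=f(x)p-f(xp)$. A Hilbert $\mathbb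 O$-bimodule is an $\mathbb O$-bimodule $H$ with a real-bilinear map $\langle\cdot,\cdot\rangle:H\times H\to\mathbb O$ such that $\operatorname{Re}(\langle u,x\rangle p-\langle u,xp\rangle)=0$ and $\langle u,x\rangle=\overline{\langle x,u\rangle}$ for all $u,x\in H$, $p\in\mathbb O$, such that $\langle u,u\rangle$ is a nonnegative real number which vanishes only for $u=0$, and such that $H$ is complete in the norm $\|u\|=\sqrt{\langle u,u\rangle}$. Its slice cone is $\mathbb C(H)=\bigcup_{J\in\mathbb S}(\operatorname{Re}H+J\operatorname{Re}H)$. For a bounded real-linear operator $T:H\to H$ and $x,y\in H$ put $$(\langle\cdot,y\rangle\circledcirc T)(x)=\overline{\sum_{i=0}^7 e_i\operatorname{Re}\langle y,T(x\overline{e_i})\rangle},\qquad [y,T,x]=(\langle\cdot,y\rangle\circledcirc T)(x)-\langle Tx,y\rangle ;$$ equivalently, $[y,T,x]=-\sum_{i=1}^7 e_i\operatorname{Re}\langle y,B_{e_i}(T,x)\rangle$. The (corrected) adjoint $T^*:H\to H$ is the map for which $T^*y$ is the unique vector with $$\langle x,T^*y\rangle=\langle Tx,y\rangle+[y,T,x]\qquad\text{for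 all }x\in H .$$ **Theorem.** Let $H$ be a Hilbert $\mathbb O$-bimodule and $T:H\to H$ a bounded right para-linear operator. Then $T$ is self-adjoint, i.e. $T=T^*$, if and only if $\langle Tx,x\rangle\in\mathbb R$ for every $x\in\mathbb C(H)$. -/

import Mathlib

noncomputable section

/-- The octonions `𝕆`, as real coordinate vectors with respect to the basis
`e₀ = 1, e₁, …, e₇`. -/
def Octonion : Type := Fin 8 → ℝ

namespace Octonion

instance : AddCommGroup Octonion := inferInstanceAs (AddCommGroup (Fin 8 → ℝ))

instance : Module ℝ Octonion := inferInstanceAs (Module ℝ (Fin 8 → ℝ))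

/-- The basis `e₀, …, e₇`. -/
def e (i : Fin 8) : Octonion := fun j => if j = i then 1 else 0

instance : One Octonion := ⟨e 0⟩

/-- Octonion multiplication: `e₀ = 1` is the unit, `eᵢ eᵢ = -1` for `i ≥ 1`, and
`e_a e_b = e_c = -e_b e_a` for every cyclic rotation `(a b c)` of one of the oriented triples
`(123), (145), (176), (246), (257), (347), (365)`. -/
instance : Mul Octonion := ⟨fun x y => ![
  x 0 * y 0 - x 1 * y 1 - x 2 * y 2 - x 3 * y 3 - x 4 * y 4 - x 5 * y 5 - x 6 * y 6 - x 7 * y 7,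
  x 0 * y 1 + x 1 * y 0
    + (x 2 * y 3 - x 3 * y 2) + (x 4 * y 5 - x 5 * y 4) + (x 7 * y 6 - x 6 * y 7),
  x 0 * y 2 + x 2 * y 0
    + (x 3 * y 1 - x 1 * y 3) + (x 4 * y 6 - x 6 * y 4) + (x 5 * y 7 - x 7 * y 5),
  x 0 * y 3 + x 3 * y 0
    + (x 1 * y 2 - x 2 * y 1) + (x 4 * y 7 - x 7 * y 4) + (x 6 * y 5 - x 5 * y 6),
  x 0 * y 4 + x 4 * y 0
    + (x 5 * y 1 - x 1 * y 5) + (x 6 * y 2 - x 2 * y 6) + (x 7 * y 3 - x 3 * y 7),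
  x 0 * y 5 + x 5 * y 0
    + (x 1 * y 4 - x 4 * y 1) + (x 7 * y 2 - x 2 * y 7) + (x 3 * y 6 - x 6 * y 3),
  x 0 * y 6 + x 6 * y 0
    + (x 1 * y 7 - x 7 * y 1) + (x 2 * y 4 - x 4 * y 2) + (x 5 * y 3 - x 3 * y 5),
  x 0 * y 7 + x 7 * y 0
    + (x 6 * y 1 - x 1 * y 6) + (x 2 * y 5 - x 5 * y 2) + (x 3 * y 4 - x 4 * y 3)]⟩

/-- The real part `x₀` of an octonion. -/
def re (x : Octonion) : ℝ := x 0

/-- Octonionic conjugation. -/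
def conj (x : Octonion) : Octonion := fun i => if i = 0 then x i else -x i

/-- The modulus `|x| = √(x x̄)`, where `x x̄` is a nonnegative real number. -/
def abs (x : Octonion) : ℝ := Real.sqrt (re (x * conj x))

/-- `x` lies in `ℝ ⊆ 𝕆`. -/
def IsReal (x : Octonion) : Prop := ∃ r : ℝ, x = r • (1 : Octonion)

/-- The sphere `𝕊` of imaginary units. -/
def unitImaginary : Set Octonion := {J | re J = 0 ∧ abs J = 1}

end Octonion

/-- An `𝕆`-bimodule: a real vector space with real-bilinear unital left and right
multiplications by octonions such that
`[p, q, x] = [q, x, p] = [x, p, q] = -[q, p, x]`, where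
`[p, q, x] = (pq)x - p(qx)`, `[q, x, p] = (qx)p - q(xp)`, `[x, p, q] = (xp)q - x(pq)`.
In particular it is a right `𝕆`-module: `[x, p, q] = -[x, q, p]`. -/
class OctonionBimodule (M : Type*) [AddCommGroup M] [Module ℝ M] where
  /-- left multiplication `lmul p x = p x` -/
  lmul : Octonion →ₗ[ℝ] M →ₗ[ℝ] M
  /-- right multiplication `rmul x p = x p` -/
  rmul : M →ₗ[ℝ] Octonion →ₗ[ℝ] M
  one_lmul : ∀ x, lmul 1 x = x
  rmul_one : ∀ x, rmul x 1 = x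
  left_eq_middle : ∀ (p q : Octonion) (x : M),
    lmul (p * q) x - lmul p (lmul q x) = rmul (lmul q x) p - lmul q (rmul x p)
  left_eq_right : ∀ (p q : Octonion) (x : M),
    lmul (p * q) x - lmul p (lmul q x) = rmul (rmul x p) q - rmul x (p * q)
  left_alternating : ∀ (p q : Octonion) (x : M),
    lmul (p * q) x - lmul p (lmul q x) = -(lmul (q * p) x - lmul q (lmul p x))

infixr:75 " •ₗ " => OctonionBimodule.lmul
infixl:75 " •ᵣ " => OctonionBimodule.rmul

namespace OctonionBimodule

variable {M M' : Type*} [AddCommGroup M] [Module ℝ M] [OctonionBimodule M]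
  [AddCommGroup M'] [Module ℝ M'] [OctonionBimodule M']

/-- The real part `Re M = {m | [p, q, m] = 0 for all p, q}` of a bimodule. -/
def realPart (M : Type*) [AddCommGroup M] [Module ℝ M] [OctonionBimodule M] : Set M :=
  {m | ∀ p q : Octonion, (p * q) •ₗ m - p •ₗ (q •ₗ m) = 0}

/-- The projection `Re : M → Re M`, given by `Re m = (5/12) m - (1/12) ∑_{i=1}^7 eᵢ m eᵢ`. -/
def reProj (m : M) : M :=
  (5 / 12 : ℝ) • m
    - (1 / 12 : ℝ) • ∑ i ∈ Finset.univ.erase (0 : Fin 8), (Octonion.e i •ₗ m) •ᵣ Octonion.e i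

/-- The second right associator `B_p(f, x) = f(x) p - f(x p)`. -/
def secondAssoc (f : M → M') (p : Octonion) (x : M) : M' := f x •ᵣ p - f (x •ᵣ p)

/-- A map `f` is right para-linear if it is real-linear and `Re B_p(f, x) = 0` for all `p`, `x`. -/
def IsRightParaLinear (f : M → M') : Prop :=
  IsLinearMap ℝ f ∧ ∀ (p : Octonion) (x : M), reProj (secondAssoc f p x) = 0

/-- The slice cone `⋃_{J ∈ 𝕊} (Re M + J Re M)`. -/
def sliceCone (M : Type*) [AddCommGroup M] [Module ℝ M] [OctonionBimodule M] : Set M :=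
  ⋃ J ∈ Octonion.unitImaginary, {z | ∃ u ∈ realPart M, ∃ v ∈ realPart M, z = u + J •ₗ v}

end OctonionBimodule

/-- A pre-Hilbert `𝕆`-bimodule: an `𝕆`-bimodule with an `𝕆`-valued real-bilinear inner product
which is para-linear in the second variable, Hermitian and positive definite; its norm is
`‖u‖ = √⟨u, u⟩` (so positivity is the fact that `⟨u, u⟩` is the real number `‖u‖ ^ 2`).
A Hilbert `𝕆`-bimodule is one which is moreover complete, `[CompleteSpace H]`. -/
class PreHilbertOctonionBimodule (H : Type*) [NormedAddCommGroup H] [NormedSpace ℝ H]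
    extends OctonionBimodule H where
  /-- the octonion-valued inner product -/
  oinner : H →ₗ[ℝ] H →ₗ[ℝ] Octonion
  oinner_paraLinear : ∀ (u x : H) (p : Octonion),
    Octonion.re (oinner u x * p - oinner u (x •ᵣ p)) = 0
  oinner_conj : ∀ u v, oinner u v = Octonion.conj (oinner v u)
  oinner_self : ∀ u, oinner u u = (‖u‖ ^ 2) • (1 : Octonion)

notation "⟪" u ", " v "⟫ₒ" => PreHilbertOctonionBimodule.oinner u v

namespace PreHilbertOctonionBimodule

open OctonionBimodule

variable {H : Type*} [NormedAddCommGroup H] [NormedSpace ℝ H] [PreHilbertOctonionBimodule H]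

/-- The regular composition `(f ⊚ g)(x) = ∑_{i=0}^7 eᵢ Re f(g(x ēᵢ))` of an octonion-valued
functional `f` (to be used for right para-linear `f`) with a real-linear map `g`. -/
def regComp (f : H → Octonion) (g : H → H) (x : H) : Octonion :=
  ∑ i : Fin 8, Octonion.re (f (g (x •ᵣ Octonion.conj (Octonion.e i)))) • Octonion.e i

/-- The triple associator `[y, T, x] = (⟨·, y⟩ ⊚ T)(x) - ⟨T x, y⟩`. Here `⟨·, y⟩` is the conjugate
of the right para-linear functional `⟨y, ·⟩`, and accordingly `⟨·, y⟩ ⊚ T` is the conjugate of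
`⟨y, ·⟩ ⊚ T`. -/
def tripleAssoc (y : H) (T : H → H) (x : H) : Octonion :=
  Octonion.conj (regComp (fun w => ⟪y, w⟫ₒ) T x) - ⟪T x, y⟫ₒ

/-- The underlying real inner product `⟨u, v⟩_ℝ = Re ⟨u, v⟩`. -/
@[reducible] def realInnerProductSpace (H : Type*) [NormedAddCommGroup H] [NormedSpace ℝ H]
    [PreHilbertOctonionBimodule H] : InnerProductSpace ℝ H where
  inner u v := Octonion.re ⟪u, v⟫ₒ
  norm_sq_eq_re_inner u := by
    rw [oinner_self]
    change ‖u‖ ^ 2 = ‖u‖ ^ 2 * Octonion.e 0 0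
    simp [Octonion.e]
  conj_inner_symm u v := by
    rw [oinner_conj u v]
    simp [Octonion.re, Octonion.conj]
  add_left u v w := by
    simp only [map_add, LinearMap.add_apply]
    rfl
  smul_left u v r := by
    simp only [map_smul, LinearMap.smul_apply]
    rfl

theorem re_sub_eq_zero_iff (a b : Octonion) : Octonion.re (a - b) = 0 ↔ a.re = b.re :=
  sub_eq_zero (a := a 0) (b := b 0)

theorem conj_conj (a : Octonion) : a.conj.conj = a := by
  funext i
  by_cases h : i = 0 <;> simp [Octonion.conj, h]

theorem sum_re_mul_conj_e (a : Octonion) :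
    ∑ i : Fin 8, Octonion.re (a * Octonion.conj (Octonion.e i)) • Octonion.e i = a := by
  have key : ∀ i : Fin 8, Octonion.re (a * Octonion.conj (Octonion.e i)) = a i := by
    intro i
    change a 0 * Octonion.conj (Octonion.e i) 0 - a 1 * Octonion.conj (Octonion.e i) 1
      - a 2 * Octonion.conj (Octonion.e i) 2 - a 3 * Octonion.conj (Octonion.e i) 3
      - a 4 * Octonion.conj (Octonion.e i) 4 - a 5 * Octonion.conj (Octonion.e i) 5
      - a 6 * Octonion.conj (Octonion.e i) 6 - a 7 * Octonion.conj (Octonion.e i) 7 = a i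
    fin_cases i <;> simp [Octonion.conj, Octonion.e]
  funext j
  simp only [key]
  have h : ∀ f : Fin 8 → Octonion, (∑ i, f i) j = ∑ i, f i j := fun f =>
    Finset.sum_apply (M := fun _ : Fin 8 => ℝ) j Finset.univ f
  rw [h]
  have h2 : ∀ i, (a i • Octonion.e i) j = a i * (if j = i then 1 else 0) := fun i => rfl
  simp only [h2, mul_ite, mul_one, mul_zero]
  exact (Finset.sum_ite_eq (M := ℝ) Finset.univ j (fun i => a i)).trans
    (if_pos (Finset.mem_univ j))

/-- Every functional `⟨·, y⟩ ⊚ T` is represented by a unique vector. -/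
theorem existsUnique_adjoint [CompleteSpace H] (T : H →L[ℝ] H) (y : H) :
    ∃! z : H, ∀ x : H, ⟪x, z⟫ₒ = ⟪T x, y⟫ₒ + tripleAssoc y T x := by
  let _ : InnerProductSpace ℝ H := realInnerProductSpace H
  refine ⟨ContinuousLinearMap.adjoint T y, fun x => ?_, fun z hz => ?_⟩
  · have h1 : ∀ w : H, Octonion.re ⟪ContinuousLinearMap.adjoint T y, w⟫ₒ
        = Octonion.re ⟪y, T w⟫ₒ := fun w => ContinuousLinearMap.adjoint_inner_left T w y
    rw [tripleAssoc, add_sub_cancel, oinner_conj]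
    congr 1
    rw [regComp, ← sum_re_mul_conj_e ⟪ContinuousLinearMap.adjoint T y, x⟫ₒ]
    refine Finset.sum_congr rfl fun i _ => ?_
    rw [← h1, (re_sub_eq_zero_iff _ _).1 (oinner_paraLinear _ _ _)]
  · have h2 : ∀ x : H, ⟪z, x⟫ₒ = regComp (fun w => ⟪y, w⟫ₒ) T x := fun x => by
      rw [oinner_conj, hz x, tripleAssoc, add_sub_cancel, conj_conj]
    refine ext_inner_right ℝ fun x => ?_
    rw [ContinuousLinearMap.adjoint_inner_left]
    change Octonion.re ⟪z, x⟫ₒ = Octonion.re ⟪y, T x⟫ₒ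
    have h0 : Octonion.conj (Octonion.e 0) = 1 := by
      funext i
      by_cases h : i = 0 <;> simp [Octonion.conj, Octonion.e, h] <;>
        change _ = Octonion.e 0 _ <;> simp [Octonion.e, h]
    have h3 : ∀ f : Fin 8 → Octonion, Octonion.re (∑ i, f i) = ∑ i, f i 0 := fun f =>
      Finset.sum_apply (M := fun _ : Fin 8 => ℝ) 0 Finset.univ f
    have h4 : ∀ (r : ℝ) (i : Fin 8), (r • Octonion.e i) 0 = r * (if 0 = i then 1 else 0) :=
      fun r i => rfl
    rw [h2, regComp, h3]
    simp only [h4, mul_ite, mul_one, mul_zero, Finset.sum_ite_eq, Finset.mem_univ, if_true, h0]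
    rw [rmul_one]

/-- The adjoint `T*`: `T* y` is the unique vector with `⟨x, T* y⟩ = ⟨T x, y⟩ + [y, T, x]` for
all `x`. -/
def octAdjoint [CompleteSpace H] (T : H →L[ℝ] H) (y : H) : H :=
  (existsUnique_adjoint T y).choose

theorem oinner_octAdjoint [CompleteSpace H] (T : H →L[ℝ] H) (x y : H) :
    ⟪x, octAdjoint T y⟫ₒ = ⟪T x, y⟫ₒ + tripleAssoc y T x :=
  (existsUnique_adjoint T y).choose_spec.1 x

/-- `T` is self-adjoint if `T = T*`. -/
def IsOctSelfAdjoint [CompleteSpace H] (T : H →L[ℝ] H) : Prop := ⇑T = octAdjoint T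

end PreHilbertOctonionBimodule

end

/-!
The real part `Re M` of an `𝕆`-bimodule generates `M` over `𝕆`. To a line of the Fano plane with
points `p`, `q`, `t` attach `w = L_p L_q L_t`, which is an involution. The bimodule axioms give
`(R_p + L_p) (1 + w) = 0` for every line through `p`, and this forces `w₁ w₂ w₃ = -1` for the three
lines through a point. Hence a common eigenvector for `-1` of the `w` of three non-concurrent lines
is one for all seven, that is, an element of `Re M`. Left multiplication by an imaginary unit off a
line exchanges the two eigenspaces of its `w`, so `M` is recovered from `Re M` in three steps.

A right para-linear operator `T` is therefore determined by the forms `r ↦ Re ⟨T (u r), v⟩` with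
`u` and `v` in `Re H`. Its self-adjointness is their Hermitian symmetry, which by polarization
along a single slice is the reality of `⟨T x, x⟩` on the slice cone.
-/

section Ring

variable {A : Type*} [Ring A]

theorem semiconjBy_neg_symm {a b : A} (h : SemiconjBy a b (-b)) : SemiconjBy b a (-a) := by
  rw [SemiconjBy, neg_mul, h.eq, neg_mul, neg_neg]

theorem commute_mul_of_semiconjBy_neg {a b c : A} (hb : SemiconjBy a b (-b))
    (hc : SemiconjBy a c (-c)) : Commute a (b * c) := by
  rw [Commute, ← neg_mul_neg]
  nth_rw 1 [neg_mul_neg]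
  exact hb.mul_right hc

/-- The relations satisfied by `r = R_p`, `a = L_p`, `b = L_q`, `c = L_t` on an `𝕆`-bimodule, for
imaginary units `p`, `q`, `t` multiplying like the quaternions `i`, `j`, `k`. -/
structure IsTripleAction (r a b c : A) : Prop where
  sq_r : r * r = -1
  sq_a : a * a = -1
  sq_b : b * b = -1
  sq_c : c * c = -1
  ab : SemiconjBy a b (-b)
  ac : SemiconjBy a c (-c)
  bc : SemiconjBy b c (-c)
  ra : Commute r a
  commutator_rb : r * b - b * r = c - a * b
  commutator_rc : r * c - c * r = -b - a * c

namespace IsTripleAction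

variable {r a b c : A} (h : IsTripleAction r a b c)
include h

theorem commute_left : Commute a (a * b * c) := by
  rw [mul_assoc]
  exact (Commute.refl a).mul_right (commute_mul_of_semiconjBy_neg h.ab h.ac)

theorem rotate_mul : b * c * a = a * b * c := by
  rw [mul_assoc a, (commute_mul_of_semiconjBy_neg h.ab h.ac).eq]

theorem commute_mid : Commute b (a * b * c) := by
  rw [← h.rotate_mul, mul_assoc]
  exact (Commute.refl b).mul_right
    (commute_mul_of_semiconjBy_neg h.bc (semiconjBy_neg_symm h.ab))

theorem commute_right : Commute c (a * b * c) :=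
  (commute_mul_of_semiconjBy_neg (semiconjBy_neg_symm h.ac)
    (semiconjBy_neg_symm h.bc)).mul_right (Commute.refl c)

theorem mul_mul_mul_self : a * b * c * (a * b * c) = 1 := by
  linear_combination (norm := noncomm_ring) a * b * h.commute_right.eq + a * h.ab.eq * b * c * c
    - h.sq_a * b * b * c * c + h.sq_b * c * c - h.sq_c

theorem add_mul_one_add [IsAddTorsionFree A] : (r + a) * (1 + a * b * c) = 0 := by
  have hanti : r * (c - a * b) = -((c - a * b) * r) := by
    rw [← h.commutator_rb]
    linear_combination (norm := noncomm_ring) h.sq_r * b - b * h.sq_r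
  have hcomm : r * (c - a * b) - (c - a * b) * r = -(2 * (b + a * c)) := by
    linear_combination (norm := noncomm_ring)
      h.commutator_rc - a * h.commutator_rb - h.ra.eq * b + h.sq_a * b
  have hd : (r + a) * (c - a * b) = 0 := by
    have h2 : 2 * ((r + a) * (c - a * b)) = 0 := by
      linear_combination (norm := noncomm_ring) hanti + hcomm - 2 * h.sq_a * b
    exact self_eq_neg.1 (eq_neg_of_add_eq_zero_left (by rwa [← two_mul]))
  linear_combination (norm := noncomm_ring) -hd * c + (r + a) * h.sq_c

theorem mul_eq_self {E : A} (hE : (r + a) * E = 0) (hb : Commute b E) : a * b * c * E = E := by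
  have hc : c * E = -(a * b * E) := by
    linear_combination (norm := noncomm_ring) -h.commutator_rb * E - b * hE + hE * b
      + (r + a) * hb.eq + h.ab.eq * E
  linear_combination (norm := noncomm_ring) a * b * hc - a * h.ab.eq * b * E
    + h.sq_a * b * b * E - h.sq_b * E

end IsTripleAction

theorem IsTripleAction.mul_mul_eq_neg_one [IsAddTorsionFree A] {r a b₁ c₁ b₂ c₂ b₃ c₃ : A}
    (h₁ : IsTripleAction r a b₁ c₁) (h₂ : IsTripleAction r a b₂ c₂)
    (h₃ : IsTripleAction r a b₃ c₃)
    (h₁₂ : SemiconjBy b₁ (a * b₂ * c₂) (-(a * b₂ * c₂)))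
    (h₁₃ : SemiconjBy b₁ (a * b₃ * c₃) (-(a * b₃ * c₃)))
    (h₂₁ : SemiconjBy b₂ (a * b₁ * c₁) (-(a * b₁ * c₁)))
    (h₂₃ : SemiconjBy b₂ (a * b₃ * c₃) (-(a * b₃ * c₃))) :
    a * b₁ * c₁ * (a * b₂ * c₂) * (a * b₃ * c₃) = -1 := by
  set E := 1 + a * b₁ * c₁ * (a * b₂ * c₂) * (a * b₃ * c₃) with E_def
  have hE : (r + a) * E = 0 := by
    rw [E_def]
    linear_combination (norm := noncomm_ring)
      h₁.add_mul_one_add * (a * b₂ * c₂) * (a * b₃ * c₃)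
        - h₂.add_mul_one_add * (a * b₃ * c₃) + h₃.add_mul_one_add
  have comm_b₁ : Commute b₁ E := (Commute.one_right b₁).add_right <| by
    rw [mul_assoc (a * b₁ * c₁)]
    exact h₁.commute_mid.mul_right (commute_mul_of_semiconjBy_neg h₁₂ h₁₃)
  have comm_b₂ : Commute b₂ E := (Commute.one_right b₂).add_right <|
    commute_mul_of_semiconjBy_neg
      (by simpa only [neg_mul] using h₂₁.mul_right h₂.commute_mid) h₂₃
  have fix : a * b₁ * c₁ * E = E := h₁.mul_eq_self hE comm_b₁
  have hb₂E : b₂ * E = 0 := self_eq_neg.1 <| calc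
    b₂ * E = b₂ * (a * b₁ * c₁ * E) := by rw [fix]
    _ = -(a * b₁ * c₁ * E * b₂) := by
      rw [← mul_assoc, h₂₁.eq, mul_assoc, comm_b₂.eq, neg_mul, mul_assoc _ E]
    _ = -(b₂ * E) := by rw [fix, comm_b₂.eq]
  have hE0 : E = 0 := by
    linear_combination (norm := noncomm_ring) h₂.sq_b * E - b₂ * hb₂E
  exact (neg_eq_of_add_eq_zero_right hE0).symm

end Ring

/-- Since `s` exchanges the eigenspaces of `w` for `1` and `-1`, the decomposition
`x = (x - w x) / 2 + (x + w x) / 2` expresses `x` through eigenvectors for `-1`. -/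
theorem le_of_inf_eigenspace_neg_one_le {K V : Type*} [Field K] [NeZero (2 : K)] [AddCommGroup V]
    [Module K V] {N P : Submodule K V} {w s : Module.End K V} (hw : w * w = 1) (hs : s * s = -1)
    (hsw : SemiconjBy s w (-w)) (hwP : P ≤ P.comap w) (hsP : P ≤ P.comap s)
    (hsN : N ≤ N.comap s) (h : P ⊓ Module.End.eigenspace w (-1) ≤ N) : P ≤ N := by
  intro x hx
  have hww (y : V) : w (w y) = y := LinearMap.congr_fun hw y
  have hss (y : V) : s (s y) = -y := LinearMap.congr_fun hs y
  have hsw' (y : V) : s (w y) = -w (s y) := LinearMap.congr_fun hsw y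
  have hy : x - w x ∈ N := h ⟨P.sub_mem hx (hwP hx), by simp [hww]⟩
  have hws (y : V) : w (s (y + w y)) = -s (y + w y) := by
    rw [eq_neg_iff_add_eq_zero, map_add s, map_add w, hsw', map_neg, hww]
    abel
  have hz : s (x + w x) ∈ N := h ⟨hsP (P.add_mem hx (hwP hx)), by simp [-map_add, hws]⟩
  have key : x = (2 : K)⁻¹ • ((x - w x) - s (s (x + w x))) := by
    rw [hss, eq_inv_smul_iff₀ two_ne_zero, two_smul]
    abel
  rw [key]
  exact N.smul_mem _ (N.sub_mem hy (hsN hz))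

namespace Octonion

@[simp] theorem mul_apply_zero (x y : Octonion) : (x * y) 0 =
    x 0 * y 0 - x 1 * y 1 - x 2 * y 2 - x 3 * y 3 - x 4 * y 4 - x 5 * y 5 - x 6 * y 6
      - x 7 * y 7 := rfl

@[simp] theorem mul_apply_one (x y : Octonion) : (x * y) 1 =
    x 0 * y 1 + x 1 * y 0 + (x 2 * y 3 - x 3 * y 2) + (x 4 * y 5 - x 5 * y 4)
      + (x 7 * y 6 - x 6 * y 7) := rfl

@[simp] theorem mul_apply_two (x y : Octonion) : (x * y) 2 =
    x 0 * y 2 + x 2 * y 0 + (x 3 * y 1 - x 1 * y 3) + (x 4 * y 6 - x 6 * y 4)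
      + (x 5 * y 7 - x 7 * y 5) := rfl

@[simp] theorem mul_apply_three (x y : Octonion) : (x * y) 3 =
    x 0 * y 3 + x 3 * y 0 + (x 1 * y 2 - x 2 * y 1) + (x 4 * y 7 - x 7 * y 4)
      + (x 6 * y 5 - x 5 * y 6) := rfl

@[simp] theorem mul_apply_four (x y : Octonion) : (x * y) 4 =
    x 0 * y 4 + x 4 * y 0 + (x 5 * y 1 - x 1 * y 5) + (x 6 * y 2 - x 2 * y 6)
      + (x 7 * y 3 - x 3 * y 7) := rfl

@[simp] theorem mul_apply_five (x y : Octonion) : (x * y) 5 =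
    x 0 * y 5 + x 5 * y 0 + (x 1 * y 4 - x 4 * y 1) + (x 7 * y 2 - x 2 * y 7)
      + (x 3 * y 6 - x 6 * y 3) := rfl

@[simp] theorem mul_apply_six (x y : Octonion) : (x * y) 6 =
    x 0 * y 6 + x 6 * y 0 + (x 1 * y 7 - x 7 * y 1) + (x 2 * y 4 - x 4 * y 2)
      + (x 5 * y 3 - x 3 * y 5) := rfl

@[simp] theorem mul_apply_seven (x y : Octonion) : (x * y) 7 =
    x 0 * y 7 + x 7 * y 0 + (x 6 * y 1 - x 1 * y 6) + (x 2 * y 5 - x 5 * y 2)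
      + (x 3 * y 4 - x 4 * y 3) := rfl

@[simp] theorem add_apply (x y : Octonion) (i : Fin 8) : (x + y) i = x i + y i := rfl

@[simp] theorem sub_apply (x y : Octonion) (i : Fin 8) : (x - y) i = x i - y i := rfl

@[simp] theorem neg_apply (x : Octonion) (i : Fin 8) : (-x) i = -x i := rfl

@[simp] theorem zero_apply (i : Fin 8) : (0 : Octonion) i = 0 := rfl

@[simp] theorem smul_apply (r : ℝ) (x : Octonion) (i : Fin 8) : (r • x) i = r * x i := rfl

@[simp] theorem one_apply (i : Fin 8) : (1 : Octonion) i = if i = 0 then 1 else 0 := rfl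

@[simp] theorem e_apply (i j : Fin 8) : e i j = if j = i then 1 else 0 := rfl

@[simp] theorem conj_apply (x : Octonion) (i : Fin 8) : conj x i = if i = 0 then x i else -x i :=
  rfl

theorem ext_coord {x y : Octonion} (h0 : x 0 = y 0) (h1 : x 1 = y 1) (h2 : x 2 = y 2)
    (h3 : x 3 = y 3) (h4 : x 4 = y 4) (h5 : x 5 = y 5) (h6 : x 6 = y 6) (h7 : x 7 = y 7) :
    x = y := by
  funext i
  fin_cases i <;> assumption

theorem e_zero : e 0 = 1 := rfl

theorem sum_smul_e (x : Octonion) : ∑ i, x i • e i = x := by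
  rw [Fin.sum_univ_eight]
  apply ext_coord <;> simp

instance : NonAssocRing Octonion where
  left_distrib _ _ _ := by apply ext_coord <;> simp <;> ring
  right_distrib _ _ _ := by apply ext_coord <;> simp <;> ring
  zero_mul _ := by apply ext_coord <;> simp
  mul_zero _ := by apply ext_coord <;> simp
  one_mul _ := by apply ext_coord <;> simp
  mul_one _ := by apply ext_coord <;> simp

instance : IsScalarTower ℝ Octonion Octonion where
  smul_assoc _ _ _ := by apply ext_coord <;> simp <;> ring

instance : SMulCommClass ℝ Octonion Octonion where
  smul_comm _ _ _ := by apply ext_coord <;> simp <;> ring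

theorem mul_add_mul_swap (x y : Octonion) :
    x * y + y * x = (2 * x 0) • y + (2 * y 0) • x - (2 * ∑ i, x i * y i) • (1 : Octonion) := by
  apply ext_coord <;> simp [Fin.sum_univ_eight] <;> ring

theorem e_mul_self {i : Fin 8} (hi : i ≠ 0) : e i * e i = -1 := by
  fin_cases i <;> first | exact absurd rfl hi | apply ext_coord <;> simp

theorem e_mul_e_swap {i j : Fin 8} (hi : i ≠ 0) (hj : j ≠ 0) (hij : i ≠ j) :
    e i * e j = -(e j * e i) := by
  refine eq_neg_of_add_eq_zero_left ?_
  rw [mul_add_mul_swap]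
  simp [hi.symm, hj.symm, hij.symm]

/-- The seven lines of the Fano plane, that is the oriented triples of the multiplication table. -/
def line : Fin 7 → Fin 3 → Fin 8 :=
  ![![1, 2, 3], ![1, 4, 5], ![1, 7, 6], ![2, 4, 6], ![2, 5, 7], ![3, 4, 7], ![3, 6, 5]]

theorem line_ne_zero (l : Fin 7) (a : Fin 3) : line l a ≠ 0 := by
  revert l a
  decide

theorem line_injective (l : Fin 7) : Function.Injective (line l) := by
  revert l
  decide

theorem eq_of_line_eq_line {l m : Fin 7} (hlm : l ≠ m) {a b a' b' : Fin 3}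
    (ha : line l a = line m a') (hb : line l b = line m b') : a = b := by
  revert l m a b a' b'
  decide

theorem exists_line_eq_line (l m : Fin 7) : ∃ a b, line l a = line m b := by
  revert l m
  decide

theorem exists_line_of_ne {i j : Fin 8} (hi : i ≠ 0) (hj : j ≠ 0) (hij : i ≠ j) :
    ∃ l a b, line l a = i ∧ line l b = j := by
  revert i j
  decide

theorem e_line_mul_e_line (l : Fin 7) (a : Fin 3) :
    e (line l a) * e (line l (a + 1)) = e (line l (a + 2)) := by
  fin_cases l <;> fin_cases a <;> apply ext_coord <;> simp [line]

theorem e_line_mul_e_line_add_two (l : Fin 7) (a : Fin 3) :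
    e (line l a) * e (line l (a + 2)) = -e (line l (a + 1)) := by
  have hne : a ≠ a + 2 := by
    revert a
    decide
  have h := e_line_mul_e_line l (a + 2)
  rw [add_assoc, add_assoc] at h
  rw [e_mul_e_swap (line_ne_zero l a) (line_ne_zero l _) ((line_injective l).ne hne), neg_inj]
  simpa using h

theorem exists_mul_e_mul_e_eq {l : Fin 8} (hl : l ≠ 0) :
    ∃ i j k, e i * e j * e k = e l ∧ e i * (e j * e k) = -e l := by
  have key : ∀ i j k : Fin 8, e i * e j * e k = e l ∧ e i * (e j * e k) = -e l →
      ∃ i j k, e i * e j * e k = e l ∧ e i * (e j * e k) = -e l :=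
    fun i j k h => ⟨i, j, k, h⟩
  fin_cases l
  · exact absurd rfl hl
  · refine key 4 2 7 ⟨?_, ?_⟩ <;> apply ext_coord <;> simp
  · refine key 1 4 7 ⟨?_, ?_⟩ <;> apply ext_coord <;> simp
  · refine key 4 1 6 ⟨?_, ?_⟩ <;> apply ext_coord <;> simp
  · refine key 2 1 7 ⟨?_, ?_⟩ <;> apply ext_coord <;> simp
  · refine key 1 2 6 ⟨?_, ?_⟩ <;> apply ext_coord <;> simp
  · refine key 2 1 5 ⟨?_, ?_⟩ <;> apply ext_coord <;> simp
  · refine key 1 2 4 ⟨?_, ?_⟩ <;> apply ext_coord <;> simp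

theorem map_eq_re_smul {V : Type*} [AddCommGroup V] [Module ℝ V] {f : Octonion →ₗ[ℝ] V}
    (hf : ∀ x y z : Octonion, f (x * y * z) = f (x * (y * z))) (p : Octonion) :
    f p = re p • f 1 := by
  have map_e (l : Fin 8) (hl : l ≠ 0) : f (e l) = 0 := by
    obtain ⟨i, j, k, hassoc, hassoc'⟩ := exists_mul_e_mul_e_eq hl
    have h : f (e l) = -f (e l) := by rw [← map_neg, ← hassoc', ← hf, hassoc]
    have : IsAddTorsionFree V := .of_isTorsionFree ℝ V
    exact self_eq_neg.1 h
  nth_rw 1 [← sum_smul_e p]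
  rw [map_sum, Finset.sum_eq_single 0 (by simp +contextual [map_e]) (by simp)]
  simp [e_zero, re]

theorem conj_one : conj 1 = 1 := by
  apply ext_coord <;> simp

theorem conj_neg (x : Octonion) : conj (-x) = -conj x := by
  apply ext_coord <;> simp

theorem conj_mul (x y : Octonion) : conj (x * y) = conj y * conj x := by
  apply ext_coord <;> simp <;> ring

theorem conj_eq_neg {x : Octonion} (h : re x = 0) : conj x = -x := by
  have h0 : x 0 = 0 := h
  apply ext_coord <;> simp [h0]

theorem re_conj (x : Octonion) : re (conj x) = re x := by
  simp [re]

theorem re_conj_mul (x p : Octonion) : re (conj x * p) = re (x * conj p) := by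
  simp [re]

theorem re_mul_conj_mul {x y : Octonion} (hx : re x = 0) (hy : re y = 0) :
    re (x * conj (x * y)) = 0 := by
  have hx0 : x 0 = 0 := hx
  have hy0 : y 0 = 0 := hy
  simp [re, hx0, hy0]
  ring

theorem exists_eq_smul_one_add (x : Octonion) :
    ∃ r : ℝ, ∃ k, re k = 0 ∧ x = r • 1 + k ∧ conj x = r • 1 - k := by
  refine ⟨re x, x - re x • 1, by simp [re], by abel, ?_⟩
  apply ext_coord <;> simp [re]

theorem sum_e_mul_mul_e (p : Octonion) : (5 / 12 : ℝ) • p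
    - (1 / 12 : ℝ) • ∑ i ∈ Finset.univ.erase (0 : Fin 8), (e i * p) * e i = re p • 1 := by
  have h : Finset.univ.erase (0 : Fin 8) = {1, 2, 3, 4, 5, 6, 7} := by decide
  simp only [h, Finset.sum_insert, Finset.mem_insert, Finset.mem_singleton, Finset.sum_singleton,
    Fin.reduceEq, or_self, not_false_eq_true]
  apply ext_coord <;> simp [re] <;> ring

theorem isReal_iff (c : Octonion) : IsReal c ↔ ∀ k : Octonion, re k = 0 → re (c * k) = 0 := by
  constructor
  · rintro ⟨r, rfl⟩ k hk
    have h0 : k 0 = 0 := hk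
    simp [re, h0]
  · intro h
    have coord (i : Fin 8) (hi : i ≠ 0) : c i = 0 := by
      have := h (e i) (by simp [re, hi.symm])
      fin_cases i <;> simp_all [re]
    exact ⟨re c, by apply ext_coord <;> simp [re, coord]⟩

theorem e_one_mem_unitImaginary : e 1 ∈ unitImaginary := by
  constructor <;> simp [re, abs]

/-- The real part as a linear functional. -/
def reLin : Octonion →ₗ[ℝ] ℝ := LinearMap.proj (φ := fun _ : Fin 8 => ℝ) 0

end Octonion

noncomputable section

namespace OctonionBimodule

open Octonion

variable (M : Type*) [AddCommGroup M] [Module ℝ M] [OctonionBimodule M]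

/-- Left multiplication by `p` as an endomorphism. -/
def leftEnd (p : Octonion) : Module.End ℝ M := lmul p

/-- Right multiplication by `p` as an endomorphism. -/
def rightEnd (p : Octonion) : Module.End ℝ M := rmul.flip p

variable {M}

theorem leftEnd_apply (p : Octonion) (x : M) : leftEnd M p x = p •ₗ x := rfl

theorem rightEnd_apply (p : Octonion) (x : M) : rightEnd M p x = x •ᵣ p := rfl

theorem lmul_lmul_self (p : Octonion) (x : M) : p •ₗ (p •ₗ x) = (p * p) •ₗ x := by
  have : IsAddTorsionFree M := .of_isTorsionFree ℝ M
  exact (sub_eq_zero.1 (self_eq_neg.1 (left_alternating p p x))).symm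

theorem rmul_rmul_self (p : Octonion) (x : M) : (x •ᵣ p) •ᵣ p = x •ᵣ (p * p) := by
  have h := left_eq_right p p x
  rw [lmul_lmul_self, sub_self] at h
  exact sub_eq_zero.1 h.symm

theorem rmul_lmul_self (p : Octonion) (x : M) : (p •ₗ x) •ᵣ p = p •ₗ (x •ᵣ p) := by
  have h := left_eq_middle p p x
  rw [lmul_lmul_self, sub_self] at h
  exact sub_eq_zero.1 h.symm

theorem leftEnd_mul_self {p : Octonion} (h : p * p = -1) : leftEnd M p * leftEnd M p = -1 := by
  ext x
  simp [leftEnd_apply, lmul_lmul_self, h, one_lmul]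

theorem rightEnd_mul_self {p : Octonion} (h : p * p = -1) :
    rightEnd M p * rightEnd M p = -1 := by
  ext x
  simp [rightEnd_apply, rmul_rmul_self, h, rmul_one]

theorem commute_rightEnd_leftEnd (p : Octonion) : Commute (rightEnd M p) (leftEnd M p) := by
  ext x
  exact rmul_lmul_self p x

theorem semiconjBy_leftEnd {p q : Octonion} (h : p * q = -(q * p)) :
    SemiconjBy (leftEnd M p) (leftEnd M q) (-leftEnd M q) := by
  ext x
  have := left_alternating p q x
  rw [h, map_neg, LinearMap.neg_apply, sub_eq_iff_eq_add] at this
  simp only [Module.End.mul_apply, LinearMap.neg_apply, leftEnd_apply]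
  rw [eq_comm, ← sub_eq_zero, ← sub_eq_zero.2 this]
  abel

theorem rightEnd_mul_leftEnd_sub (p q : Octonion) :
    rightEnd M p * leftEnd M q - leftEnd M q * rightEnd M p
      = leftEnd M (p * q) - leftEnd M p * leftEnd M q := by
  ext x
  exact (left_eq_middle p q x).symm

/-- Left multiplication by the product of the three points of a line of the Fano plane, taken one
after the other; an element of `Re M` is an eigenvector for `-1`. -/
def lineEnd (M : Type*) [AddCommGroup M] [Module ℝ M] [OctonionBimodule M] (l : Fin 7) :
    Module.End ℝ M :=
  leftEnd M (e (line l 0)) * leftEnd M (e (line l 1)) * leftEnd M (e (line l 2))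

theorem leftEnd_e_mul_self {i : Fin 8} (hi : i ≠ 0) : leftEnd M (e i) * leftEnd M (e i) = -1 :=
  leftEnd_mul_self (e_mul_self hi)

theorem semiconjBy_leftEnd_e {i j : Fin 8} (hi : i ≠ 0) (hj : j ≠ 0) (hij : i ≠ j) :
    SemiconjBy (leftEnd M (e i)) (leftEnd M (e j)) (-leftEnd M (e j)) :=
  semiconjBy_leftEnd (e_mul_e_swap hi hj hij)

theorem semiconjBy_leftEnd_line (l : Fin 7) {a b : Fin 3} (hab : a ≠ b) :
    SemiconjBy (leftEnd M (e (line l a))) (leftEnd M (e (line l b)))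
      (-leftEnd M (e (line l b))) :=
  semiconjBy_leftEnd_e (line_ne_zero l a) (line_ne_zero l b) ((line_injective l).ne hab)

theorem isTripleAction_line (l : Fin 7) (a : Fin 3) :
    IsTripleAction (rightEnd M (e (line l a))) (leftEnd M (e (line l a)))
      (leftEnd M (e (line l (a + 1)))) (leftEnd M (e (line l (a + 2)))) where
  sq_r := rightEnd_mul_self (e_mul_self (line_ne_zero l a))
  sq_a := leftEnd_e_mul_self (line_ne_zero l a)
  sq_b := leftEnd_e_mul_self (line_ne_zero l (a + 1))
  sq_c := leftEnd_e_mul_self (line_ne_zero l (a + 2))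
  ab := semiconjBy_leftEnd_line l (by simp)
  ac := semiconjBy_leftEnd_line l (by simp)
  bc := semiconjBy_leftEnd_line l (by simp)
  ra := commute_rightEnd_leftEnd _
  commutator_rb := by rw [rightEnd_mul_leftEnd_sub, e_line_mul_e_line]
  commutator_rc := by
    rw [rightEnd_mul_leftEnd_sub, e_line_mul_e_line_add_two]
    simp [leftEnd]

theorem lineEnd_eq_rotate (l : Fin 7) (a : Fin 3) :
    lineEnd M l = leftEnd M (e (line l a)) * leftEnd M (e (line l (a + 1)))
      * leftEnd M (e (line l (a + 2))) := by
  have h := (isTripleAction_line (M := M) l 0).rotate_mul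
  have h' := (isTripleAction_line (M := M) l 1).rotate_mul
  fin_cases a
  · rfl
  · exact h.symm
  · exact (h'.trans h).symm

theorem lineEnd_mul_self (l : Fin 7) : lineEnd M l * lineEnd M l = 1 :=
  (isTripleAction_line l 0).mul_mul_mul_self

theorem commute_leftEnd_lineEnd (l : Fin 7) (a : Fin 3) :
    Commute (leftEnd M (e (line l a))) (lineEnd M l) := by
  rw [lineEnd_eq_rotate l a]
  exact (isTripleAction_line l a).commute_left

theorem semiconjBy_lineEnd {l : Fin 7} {i : Fin 8} (hi : i ≠ 0) (hil : ∀ a, line l a ≠ i) :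
    SemiconjBy (leftEnd M (e i)) (lineEnd M l) (-lineEnd M l) := by
  have h (a : Fin 3) := semiconjBy_leftEnd_e (M := M) hi (line_ne_zero l a) (hil a).symm
  simpa [lineEnd] using ((h 0).mul_right (h 1)).mul_right (h 2)

theorem semiconjBy_leftEnd_lineEnd {l m : Fin 7} (hlm : l ≠ m) {a b b' : Fin 3}
    (hb : line l b = line m b') (hab : a ≠ b) :
    SemiconjBy (leftEnd M (e (line l a))) (lineEnd M m) (-lineEnd M m) :=
  semiconjBy_lineEnd (line_ne_zero l a) fun _ h =>
    hab (eq_of_line_eq_line hlm h.symm hb)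

theorem lineEnd_mul_lineEnd_mul_lineEnd {l m n : Fin 7} (hlm : l ≠ m) (hln : l ≠ n) (hmn : m ≠ n)
    {a b c : Fin 3} (hab : line l a = line m b) (hac : line l a = line n c) :
    lineEnd M l * lineEnd M m * lineEnd M n = -1 := by
  have hl := isTripleAction_line (M := M) l a
  have hm := isTripleAction_line (M := M) m b
  have hn := isTripleAction_line (M := M) n c
  rw [← hab] at hm
  rw [← hac] at hn
  have : IsAddTorsionFree (Module.End ℝ M) := .of_isTorsionFree ℝ _
  have succ_ne (a : Fin 3) : a + 1 ≠ a := by revert a; decide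
  have key := hl.mul_mul_eq_neg_one hm hn
  rw [hab, ← lineEnd_eq_rotate m b, ← hab, hac, ← lineEnd_eq_rotate n c, ← hac,
    ← lineEnd_eq_rotate l a] at key
  exact key (semiconjBy_leftEnd_lineEnd hlm hab (succ_ne a))
    (semiconjBy_leftEnd_lineEnd hln hac (succ_ne a))
    (semiconjBy_leftEnd_lineEnd hlm.symm hab.symm (succ_ne b))
    (semiconjBy_leftEnd_lineEnd hmn (hab.symm.trans hac) (succ_ne b))

theorem lineEnd_apply_eq_neg {l m n : Fin 7} (hlm : l ≠ m) (hln : l ≠ n) (hmn : m ≠ n)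
    {a b c : Fin 3} (hab : line l a = line m b) (hac : line l a = line n c) {x : M}
    (hl : lineEnd M l x = -x) (hm : lineEnd M m x = -x) : lineEnd M n x = -x := by
  have h := LinearMap.congr_fun (lineEnd_mul_lineEnd_mul_lineEnd (M := M) hmn.symm hln.symm
    hlm.symm (hac.symm.trans hab) hac.symm) x
  simpa [hl, hm] using h

theorem commute_lineEnd {l m : Fin 7} (hlm : l ≠ m) : Commute (lineEnd M l) (lineEnd M m) := by
  obtain ⟨a, b, hab⟩ := exists_line_eq_line l m
  have h₁ := semiconjBy_leftEnd_lineEnd (M := M) hlm (a := a + 1) hab (by simp)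
  have h₂ := semiconjBy_leftEnd_lineEnd (M := M) hlm (a := a + 2) hab (by simp)
  rw [lineEnd_eq_rotate l a, mul_assoc, hab]
  refine (commute_leftEnd_lineEnd m b).mul_left (SemiconjBy.mul_left ?_ h₂)
  simpa using h₁.neg_right

theorem mul_lmul_swap {p q : Octonion} {x : M} (h : (p * q) •ₗ x = p •ₗ (q •ₗ x)) :
    (q * p) •ₗ x = q •ₗ (p •ₗ x) := by
  have := left_alternating q p x
  rw [h, sub_self, neg_zero] at this
  exact sub_eq_zero.1 this

theorem mul_lmul_of_lineEnd {l : Fin 7} {x : M} (h : lineEnd M l x = -x) (a b : Fin 3) :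
    (e (line l a) * e (line l b)) •ₗ x = e (line l a) •ₗ (e (line l b) •ₗ x) := by
  have succ (a : Fin 3) : (e (line l a) * e (line l (a + 1))) •ₗ x
      = e (line l a) •ₗ (e (line l (a + 1)) •ₗ x) := by
    rw [e_line_mul_e_line, ← neg_inj, ← map_neg, ← h, lineEnd_eq_rotate l (a + 2)]
    simp [leftEnd_apply, lmul_lmul_self, e_mul_self (line_ne_zero l _), one_lmul, add_assoc]
  obtain rfl | rfl | rfl : b = a ∨ b = a + 1 ∨ a = b + 1 := by
    revert a b
    decide
  · exact (lmul_lmul_self _ x).symm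
  · exact succ a
  · exact mul_lmul_swap (succ b)

theorem mem_realPart_iff {x : M} :
    x ∈ realPart M ↔ ∀ p q : Octonion, (p * q) •ₗ x = p •ₗ (q •ₗ x) := by
  simp only [realPart, Set.mem_ofPred_eq, sub_eq_zero]

theorem mem_realPart_of_e {x : M}
    (h : ∀ i j, (e i * e j) •ₗ x = e i •ₗ (e j •ₗ x)) : x ∈ realPart M := by
  rw [mem_realPart_iff]
  intro p q
  rw [← sum_smul_e p, ← sum_smul_e q]
  simp only [Finset.sum_mul_sum, smul_mul_smul_comm, map_sum, map_smul, LinearMap.sum_apply,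
    LinearMap.smul_apply, Finset.smul_sum, h, mul_smul]
  rw [Finset.sum_comm]
  exact Finset.sum_congr rfl fun i _ => Finset.sum_congr rfl fun j _ => smul_comm _ _ _

theorem mem_realPart_of_lineEnd {x : M} (h : ∀ l, lineEnd M l x = -x) : x ∈ realPart M := by
  refine mem_realPart_of_e fun i j => ?_
  rcases eq_or_ne i 0 with rfl | hi
  · simp [e_zero, one_lmul]
  rcases eq_or_ne j 0 with rfl | hj
  · simp [e_zero, one_lmul]
  rcases eq_or_ne i j with rfl | hij
  · exact (lmul_lmul_self _ x).symm
  obtain ⟨l, a, b, rfl, rfl⟩ := exists_line_of_ne hi hj hij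
  exact mul_lmul_of_lineEnd (h l) a b

theorem mem_realPart_of_three_lineEnd {x : M} (h₀ : lineEnd M 0 x = -x)
    (h₁ : lineEnd M 1 x = -x) (h₃ : lineEnd M 3 x = -x) : x ∈ realPart M := by
  have third {l m n : Fin 7} (hne : l ≠ m ∧ l ≠ n ∧ m ≠ n) (a b c : Fin 3)
      (hl : lineEnd M l x = -x) (hm : lineEnd M m x = -x)
      (hmeet : line l a = line m b ∧ line l a = line n c) : lineEnd M n x = -x :=
    lineEnd_apply_eq_neg hne.1 hne.2.1 hne.2.2 hmeet.1 hmeet.2 hl hm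
  have h₂ : lineEnd M 2 x = -x := third (by decide) 0 0 0 h₀ h₁ (by decide)
  have h₄ : lineEnd M 4 x = -x := third (by decide) 1 0 0 h₀ h₃ (by decide)
  have h₅ : lineEnd M 5 x = -x := third (by decide) 1 1 1 h₁ h₃ (by decide)
  have h₆ : lineEnd M 6 x = -x := third (by decide) 2 0 0 h₀ h₅ (by decide)
  refine mem_realPart_of_lineEnd fun l => ?_
  fin_cases l <;> assumption

theorem span_lmul_realPart :
    Submodule.span ℝ (Set.image2 (fun p x => p •ₗ x) Set.univ (realPart M)) = ⊤ := by
  set N := Submodule.span ℝ (Set.image2 (fun p x => p •ₗ x) Set.univ (realPart M))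
  have hN (i : Fin 8) : N ≤ N.comap (leftEnd M (e i)) := by
    refine Submodule.span_le.2 ?_
    rintro _ ⟨p, -, u, hu, rfl⟩
    refine Submodule.subset_span ⟨e i * p, Set.mem_univ _, u, hu, ?_⟩
    exact mem_realPart_iff.1 hu _ _
  let E (l : Fin 7) : Submodule ℝ M := (lineEnd M l).eigenspace (-1)
  have hW (l m : Fin 7) (hlm : l ≠ m) : E l ≤ (E l).comap (lineEnd M m) :=
    Module.End.mapsTo_genEigenspace_of_comm (commute_lineEnd hlm) (-1) 1
  have hL (l : Fin 7) (a : Fin 3) : E l ≤ (E l).comap (leftEnd M (e (line l a))) :=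
    Module.End.mapsTo_genEigenspace_of_comm (commute_leftEnd_lineEnd l a).symm (-1) 1
  have h₀₁₃ : E 0 ⊓ E 1 ⊓ E 3 ≤ N := by
    rintro x ⟨⟨h₀, h₁⟩, h₃⟩
    refine Submodule.subset_span ⟨1, Set.mem_univ _, x, ?_, one_lmul x⟩
    simp only [E, SetLike.mem_coe, Module.End.mem_eigenspace_iff, neg_smul, one_smul] at h₀ h₁ h₃
    exact mem_realPart_of_three_lineEnd h₀ h₁ h₃
  have h₀₁ : E 0 ⊓ E 1 ≤ N :=
    le_of_inf_eigenspace_neg_one_le (lineEnd_mul_self 3) (leftEnd_e_mul_self (i := 1) (by decide))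
      (semiconjBy_lineEnd (by decide) (by decide))
      (inf_le_inf (hW 0 3 (by decide)) (hW 1 3 (by decide)))
      (inf_le_inf (hL 0 0) (hL 1 0)) (hN 1) h₀₁₃
  have h₀ : E 0 ≤ N :=
    le_of_inf_eigenspace_neg_one_le (lineEnd_mul_self 1) (leftEnd_e_mul_self (i := 2) (by decide))
      (semiconjBy_lineEnd (by decide) (by decide)) (hW 0 1 (by decide)) (hL 0 1) (hN 2) h₀₁
  exact eq_top_iff.2 <|
    le_of_inf_eigenspace_neg_one_le (lineEnd_mul_self 0) (leftEnd_e_mul_self (i := 4) (by decide))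
      (semiconjBy_lineEnd (by decide) (by decide)) le_top le_top (hN 4) (inf_le_right.trans h₀)

theorem add_mem_realPart {u v : M} (hu : u ∈ realPart M) (hv : v ∈ realPart M) :
    u + v ∈ realPart M := by
  rw [mem_realPart_iff] at *
  simp [hu, hv]

theorem zero_mem_realPart : (0 : M) ∈ realPart M := by
  simp [mem_realPart_iff]

section RealElement

variable {u : M} (hu : u ∈ realPart M)
include hu

theorem mul_lmul_of_mem (p q : Octonion) : (p * q) •ₗ u = p •ₗ (q •ₗ u) :=
  mem_realPart_iff.1 hu p q

theorem rmul_rmul_of_mem (p q : Octonion) : (u •ᵣ p) •ᵣ q = u •ᵣ (p * q) := by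
  have h := left_eq_right p q u
  rw [mul_lmul_of_mem hu, sub_self] at h
  exact sub_eq_zero.1 h.symm

theorem lmul_rmul_of_mem (p q : Octonion) : (p •ₗ u) •ᵣ q = p •ₗ (u •ᵣ q) := by
  have h := left_eq_middle q p u
  rw [mul_lmul_of_mem hu, sub_self] at h
  exact sub_eq_zero.1 h.symm

theorem lmul_eq_rmul_of_mem (p : Octonion) : p •ₗ u = u •ᵣ p := by
  have vanish_on_assoc (x y z : Octonion) :
      (lmul.flip u - rmul u) (x * y * z) = (lmul.flip u - rmul u) (x * (y * z)) := by
    simp only [LinearMap.sub_apply, LinearMap.flip_apply]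
    rw [sub_eq_sub_iff_sub_eq_sub]
    calc (x * y * z) •ₗ u - (x * (y * z)) •ₗ u
        = (x * y) •ₗ (z •ₗ u) - x •ₗ (y •ₗ (z •ₗ u)) := by simp only [mul_lmul_of_mem hu]
      _ = (y •ₗ (z •ₗ u)) •ᵣ x - y •ₗ ((z •ₗ u) •ᵣ x) := left_eq_middle x y _
      _ = (y * z) •ₗ (u •ᵣ x) - y •ₗ (z •ₗ (u •ᵣ x)) := by
        simp only [← mul_lmul_of_mem hu, lmul_rmul_of_mem hu]
      _ = ((u •ᵣ x) •ᵣ y) •ᵣ z - (u •ᵣ x) •ᵣ (y * z) := left_eq_right y z _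
      _ = u •ᵣ (x * y * z) - u •ᵣ (x * (y * z)) := by simp only [rmul_rmul_of_mem hu]
  have h := map_eq_re_smul vanish_on_assoc p
  simpa [one_lmul, rmul_one, sub_eq_zero] using h

theorem lmul_rmul_eq_mul_lmul_of_mem (p q : Octonion) : (p •ₗ u) •ᵣ q = (p * q) •ₗ u := by
  rw [lmul_rmul_of_mem hu, ← lmul_eq_rmul_of_mem hu, mul_lmul_of_mem hu]

theorem reProj_lmul_of_mem (p : Octonion) : reProj (p •ₗ u) = re p • u := by
  have h := congrArg (fun a => a •ₗ u) (sum_e_mul_mul_e p)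
  simpa only [reProj, ← mul_lmul_of_mem hu, lmul_rmul_eq_mul_lmul_of_mem hu, map_sub, map_smul,
    map_sum, LinearMap.sub_apply, LinearMap.smul_apply, LinearMap.sum_apply, one_lmul] using h

end RealElement

theorem reProj_add (x y : M) : reProj (x + y) = reProj x + reProj y := by
  simp only [reProj, map_add, LinearMap.add_apply, Finset.sum_add_distrib]
  module

@[elab_as_elim]
theorem realPart_induction {C : M → Prop} (x : M) (add : ∀ x y, C x → C y → C (x + y))
    (rmul : ∀ u ∈ realPart M, ∀ p : Octonion, C (u •ᵣ p)) : C x := by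
  have hx : x ∈ Submodule.span ℝ (Set.image2 (fun p x => p •ₗ x) Set.univ (realPart M)) := by
    rw [span_lmul_realPart]
    trivial
  induction hx using Submodule.closure_induction with
  | zero => simpa using rmul 0 zero_mem_realPart 0
  | add x y _ _ hx hy => exact add x y hx hy
  | smul_mem r x hx =>
    obtain ⟨p, -, u, hu, rfl⟩ := hx
    simpa [lmul_eq_rmul_of_mem hu] using rmul u hu (r • p)

end OctonionBimodule

namespace PreHilbertOctonionBimodule

open Octonion OctonionBimodule

variable (H : Type*) [NormedAddCommGroup H] [NormedSpace ℝ H] [PreHilbertOctonionBimodule H]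

/-- The real inner product `Re ⟨x, y⟩` underlying the octonion-valued one, as a bilinear form. -/
def reInner : H →ₗ[ℝ] H →ₗ[ℝ] ℝ := oinner.compr₂ reLin

variable {H}

theorem reInner_apply (x y : H) : reInner H x y = re ⟪x, y⟫ₒ := rfl

theorem reInner_comm (x y : H) : reInner H x y = reInner H y x := by
  rw [reInner_apply, oinner_conj, re_conj, reInner_apply]

theorem eq_zero_of_reInner_self {x : H} (h : reInner H x x = 0) : x = 0 := by
  rw [reInner_apply, oinner_self] at h
  simpa [re] using h

theorem re_oinner_mul (x y : H) (p : Octonion) : re (⟪x, y⟫ₒ * p) = reInner H x (y •ᵣ p) :=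
  (re_sub_eq_zero_iff _ _).1 (oinner_paraLinear _ _ _)

theorem isReal_oinner_iff (x y : H) :
    IsReal ⟪x, y⟫ₒ ↔ ∀ k : Octonion, re k = 0 → reInner H x (y •ᵣ k) = 0 := by
  simp only [isReal_iff, re_oinner_mul]

theorem reInner_rmul_left (x y : H) (p : Octonion) :
    reInner H (x •ᵣ p) y = reInner H x (y •ᵣ conj p) := by
  rw [reInner_comm, ← re_oinner_mul, oinner_conj, re_conj_mul, re_oinner_mul]

theorem reInner_rmul_right (x y : H) (p : Octonion) :
    reInner H x (y •ᵣ p) = reInner H (x •ᵣ conj p) y := by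
  rw [reInner_rmul_left, conj_conj]

theorem reInner_rmul_of_mem {u v : H} (hu : u ∈ realPart H) (hv : v ∈ realPart H)
    (p : Octonion) : reInner H u (v •ᵣ p) = re p * reInner H u v := by
  have assoc (x y z : Octonion) : reInner H u (v •ᵣ (x * y * z)) =
      reInner H u (v •ᵣ (x * (y * z))) := by
    simp only [← rmul_rmul_of_mem hv]
    simp only [reInner_rmul_right, rmul_rmul_of_mem hu, conj_mul]
  have h := map_eq_re_smul (f := reInner H u ∘ₗ OctonionBimodule.rmul v) assoc p
  simpa [rmul_one] using h

theorem reInner_reProj {v : H} (hv : v ∈ realPart H) (w : H) :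
    reInner H (reProj w) v = reInner H w v := by
  induction w using realPart_induction with
  | add x y hx hy => simp only [reProj_add, map_add, LinearMap.add_apply, hx, hy]
  | rmul u hu p =>
    rw [reInner_rmul_left, reInner_rmul_of_mem hu hv, ← lmul_eq_rmul_of_mem hu,
      reProj_lmul_of_mem hu, re_conj, map_smul, LinearMap.smul_apply, smul_eq_mul]

/-- The forms `r ↦ Re ⟨T (u r), v⟩`, for real elements `u` and `v`, determine a right para-linear
map `T`; this is the symmetry in `u` and `v` that makes `T` self-adjoint. -/
def IsHermitianOnRealPart (T : H →ₗ[ℝ] H) : Prop :=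
  ∀ u ∈ realPart H, ∀ v ∈ realPart H, ∀ r : Octonion,
    reInner H (T (u •ᵣ r)) v = reInner H (T (v •ᵣ conj r)) u

section ParaLinear

variable {T : H →ₗ[ℝ] H} (hT : IsRightParaLinear T)
include hT

theorem reInner_map_rmul {v : H} (hv : v ∈ realPart H) (x : H) (p : Octonion) :
    reInner H (T (x •ᵣ p)) v = reInner H (T x •ᵣ p) v := by
  have h := reInner_reProj hv (secondAssoc T p x)
  rw [hT.2, map_zero, LinearMap.zero_apply, secondAssoc, map_sub, LinearMap.sub_apply] at h
  exact (sub_eq_zero.1 h.symm).symm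

theorem reInner_map_rmul_rmul {v : H} (hv : v ∈ realPart H) (x : H) (p : Octonion) :
    reInner H (T x) (v •ᵣ p) = reInner H (T (x •ᵣ conj p)) v := by
  rw [reInner_rmul_right, reInner_map_rmul hT hv]

theorem isSelfAdjoint_reInner_iff :
    (reInner H).IsSelfAdjoint T ↔ IsHermitianOnRealPart T := by
  constructor
  · intro h u hu v _ r
    rw [h, reInner_comm, reInner_map_rmul_rmul hT hu]
  · intro h x y
    induction x using realPart_induction with
    | add x x' hx hx' => simp only [map_add, LinearMap.add_apply, hx, hx']
    | rmul u hu p =>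
      induction y using realPart_induction with
      | add y y' hy hy' => simp only [map_add, hy, hy']
      | rmul v hv q =>
        rw [reInner_map_rmul_rmul hT hv, rmul_rmul_of_mem hu, h u hu v hv, conj_mul, conj_conj,
          reInner_comm (u •ᵣ p), reInner_map_rmul_rmul hT hu, rmul_rmul_of_mem hv]

theorem reInner_map_slice {u v : H} (hu : u ∈ realPart H) (hv : v ∈ realPart H)
    (J k : Octonion) :
    reInner H (T (u + J •ₗ v)) ((u + J •ₗ v) •ᵣ k) =
      reInner H (T (u •ᵣ conj k)) u + reInner H (T (u •ᵣ conj (J * k))) v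
        + reInner H (T (v •ᵣ (J * conj k))) u + reInner H (T (v •ᵣ (J * conj (J * k)))) v := by
  rw [lmul_eq_rmul_of_mem hv]
  simp only [map_add, LinearMap.add_apply]
  rw [rmul_rmul_of_mem hv, reInner_map_rmul_rmul hT hu, reInner_map_rmul_rmul hT hu,
    reInner_map_rmul_rmul hT hv, reInner_map_rmul_rmul hT hv, rmul_rmul_of_mem hv,
    rmul_rmul_of_mem hv]
  ring

theorem IsHermitianOnRealPart.isReal_oinner (h : IsHermitianOnRealPart T) {x : H}
    (hx : x ∈ sliceCone H) : IsReal ⟪T x, x⟫ₒ := by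
  have diag {u : H} (hu : u ∈ realPart H) {r : Octonion} (hr : re r = 0) :
      reInner H (T (u •ᵣ r)) u = 0 := by
    have := h u hu u hu r
    rw [conj_eq_neg hr, map_neg, map_neg, map_neg, LinearMap.neg_apply] at this
    exact self_eq_neg.1 this
  simp only [sliceCone, Set.mem_iUnion, Set.mem_ofPred_eq] at hx
  obtain ⟨J, hJ, u, hu, v, hv, rfl⟩ := hx
  refine (isReal_oinner_iff _ _).2 fun k hk => ?_
  have cross : reInner H (T (u •ᵣ conj (J * k))) v = -reInner H (T (v •ᵣ (J * conj k))) u := by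
    rw [h u hu v hv, conj_conj, conj_eq_neg hk, mul_neg]
    simp only [map_neg, LinearMap.neg_apply, neg_neg]
  rw [reInner_map_slice hT hu hv, diag hu (by rwa [re_conj]),
    diag hv (re_mul_conj_mul hJ.1 hk), cross]
  ring

theorem isHermitianOnRealPart_of_isReal_oinner (h : ∀ x ∈ sliceCone H, IsReal ⟪T x, x⟫ₒ) :
    IsHermitianOnRealPart T := by
  have slice {u v : H} (hu : u ∈ realPart H) (hv : v ∈ realPart H) {k : Octonion}
      (hk : re k = 0) : reInner H (T (u + e 1 •ₗ v)) ((u + e 1 •ₗ v) •ᵣ k) = 0 :=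
    (isReal_oinner_iff _ _).1
      (h _ (Set.mem_biUnion e_one_mem_unitImaginary ⟨u, hu, v, hv, rfl⟩)) k hk
  have diag {u : H} (hu : u ∈ realPart H) {k : Octonion} (hk : re k = 0) :
      reInner H (T (u •ᵣ k)) u = 0 := by
    have := slice hu zero_mem_realPart hk
    rw [map_zero, add_zero, reInner_map_rmul_rmul hT hu, conj_eq_neg hk, map_neg, map_neg,
      map_neg, LinearMap.neg_apply] at this
    exact neg_eq_zero.1 this
  have antisymm {u v : H} (hu : u ∈ realPart H) (hv : v ∈ realPart H) {k : Octonion}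
      (hk : re k = 0) : reInner H (T (u •ᵣ k)) v = -reInner H (T (v •ᵣ k)) u := by
    have := diag (add_mem_realPart hu hv) hk
    simp only [map_add, LinearMap.add_apply, diag hu hk, diag hv hk] at this
    linarith
  have symm {u v : H} (hu : u ∈ realPart H) (hv : v ∈ realPart H) :
      reInner H (T u) v = reInner H (T v) u := by
    have he : re (e 1) = 0 := e_one_mem_unitImaginary.1
    have := slice hu hv he
    rw [reInner_map_slice hT hu hv, e_mul_self one_ne_zero, conj_eq_neg he, mul_neg,
      e_mul_self one_ne_zero, conj_neg, conj_one, neg_neg, mul_neg, mul_one] at this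
    simp only [map_neg, LinearMap.neg_apply, diag hu he, diag hv he, rmul_one] at this
    linarith
  intro u hu v hv r
  obtain ⟨a, k, hk, hr, hconj⟩ := exists_eq_smul_one_add r
  rw [hconj, hr]
  simp only [map_add, map_sub, map_smul, LinearMap.add_apply, LinearMap.sub_apply,
    LinearMap.smul_apply, rmul_one, symm hu hv, antisymm hu hv hk]
  rw [sub_eq_add_neg]

end ParaLinear

theorem reInner_octAdjoint [CompleteSpace H] (T : H →L[ℝ] H) (x y : H) :
    reInner H x (octAdjoint T y) = reInner H (T x) y := by
  have h : re (regComp (fun w => ⟪y, w⟫ₒ) T x) = re ⟪y, T x⟫ₒ := by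
    simp [regComp, Fin.sum_univ_eight, re, e_zero, conj_one, rmul_one]
  rw [reInner_apply, oinner_octAdjoint, tripleAssoc, add_sub_cancel, re_conj, h, reInner_comm,
    reInner_apply]

theorem isOctSelfAdjoint_iff [CompleteSpace H] (T : H →L[ℝ] H) :
    IsOctSelfAdjoint T ↔ (reInner H).IsSelfAdjoint (T : H →ₗ[ℝ] H) := by
  constructor
  · intro h x y
    rw [ContinuousLinearMap.coe_coe, ← reInner_octAdjoint, ← congrFun h y]
  · intro h
    funext y
    refine sub_eq_zero.1 (eq_zero_of_reInner_self ?_)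
    rw [map_sub (reInner H (T y - octAdjoint T y)), reInner_octAdjoint, sub_eq_zero]
    exact (h _ _).symm

end PreHilbertOctonionBimodule

end

theorem mainTheorem1 {H : Type*} [NormedAddCommGroup H] [NormedSpace ℝ H] [CompleteSpace H]
    [PreHilbertOctonionBimodule H] (T : H →L[ℝ] H)
    (hT : OctonionBimodule.IsRightParaLinear T) :
    PreHilbertOctonionBimodule.IsOctSelfAdjoint T ↔
      ∀ x ∈ OctonionBimodule.sliceCone H, Octonion.IsReal ⟪T x, x⟫ₒ := by
  open PreHilbertOctonionBimodule in
  have hT' : OctonionBimodule.IsRightParaLinear (T : H →ₗ[ℝ] H) := hT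
  rw [isOctSelfAdjoint_iff, isSelfAdjoint_reInner_iff hT']
  exact ⟨fun h _ hx => h.isReal_oinner hT' hx, isHermitianOnRealPart_of_isReal_oinner hT'⟩
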